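/- Let $p$ be a prime number, $K$ a field of characteristic $p$, and $q=p^e$ with $e\ge 1$. Let $\Gamma_{q,K}$ be the set of all power series $X+\sum_{i\ge 1}a_iX^{q^i}$ with $a_i\in K$; it is a group under composition of power series. For a unit $F=F(X)$ of $K[[X]]$ put $\mathbf D[F]=XF'(X)/F(X)\in XK[[X]]$. Let $\mathbb N=\{1,2,\dots\}$ and, for $n\in\mathbb N$, let $\operatorname{ord}_p n$ be the exponent of the exact power of $p$ dividing $n$. For $c\in\mathbb N$ let $$O_q(c)=\{n\in\mathbb N \mid \gcd(n,p)=1 \text{ and } n\equiv p^ic \bmod (q-1)\text{ for some integer } i\ge 0\}.$$ Let $C_q^0$ (the set of $q$-critical integers) be the set of all $c\in\mathbb N$ with $0<c<q$, $\gcd(c,p)=1$ and $$\frac{c+1}{p^{\operatorname{ord}_p(c+1)}}=\min_{n\in O_q(c),\ 0<n<q}\ \frac{n+1}{p^{\operatorname{ord}_p(n+1)}},$$ and let $$C_q=\bigcup_{c\in C_q^0}\{q^i(c+1)-1\mid i\ge 0\}.$$ For $G=\sum_{i\ge1}a_iX^i\in XK[[X]]$ put $\psi_q[G]=X\cdot\sum_{k\in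 C_q}a_kX^k$. Then for all $\gamma\in\Gamma_{q,K}$ and all units $F$ of $K[[X]]$, $$\psi_q[\mathbf D[F\circ\gamma]]=\gamma^{-1}\circ\psi_q[\mathbf D[F]],$$ where $\gamma^{-1}$ is the inverse of $\gamma$ in the group $\Gamma_{q,K}$. -/

import Mathlib

namespace AdditiveGroupSeries

open PowerSeries

noncomputable section

/-- The coefficients of a `p ^ k`-th power in characteristic `p`. -/
theorem exists_of_coeff_pow_ne_zero {K : Type*} [Field K] {p : ℕ} [Fact p.Prime] [CharP K p]
    (g : K⟦X⟧) (k m : ℕ) (h : coeff m (g ^ p ^ k) ≠ 0) :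
    ∃ j, m = p ^ k * j ∧ coeff j g ≠ 0 := by
  have hp0 : p ≠ 0 := (Fact.out : p.Prime).ne_zero
  have key : (PowerSeries.expand (p ^ k) (pow_ne_zero k hp0) g).map (iterateFrobenius K p k)
      = g ^ p ^ k := MvPowerSeries.map_iterateFrobenius_expand p hp0 g k
  rw [← key, coeff_map, coeff_expand] at h
  split_ifs at h with hd
  · obtain ⟨j, rfl⟩ := hd
    refine ⟨j, rfl, fun hj => h ?_⟩
    rw [Nat.mul_div_cancel_left _ (pow_pos (Fact.out : p.Prime).pos k), hj, map_zero]
  · simp at h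

/-- `IsGammaSeries q f` says that `f` has the form `X + ∑_{i ≥ 1} a_i X ^ (q ^ i)`. -/
def IsGammaSeries {K : Type*} [Field K] (q : ℕ) (f : K⟦X⟧) : Prop :=
  coeff 1 f = 1 ∧ ∀ n : ℕ, coeff n f ≠ 0 → ∃ i : ℕ, n = q ^ i

/-- The set of all power series `X + ∑_{i ≥ 1} a_i X ^ (q ^ i)` with coefficients in `K`. -/
def Gamma (q : ℕ) (K : Type*) [Field K] : Type _ := {f : K⟦X⟧ // IsGammaSeries q f}

theorem isGammaSeries_X {K : Type*} [Field K] {q : ℕ} : IsGammaSeries q (X : K⟦X⟧) := by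
  refine ⟨coeff_one_X, fun n hn => ⟨0, ?_⟩⟩
  by_contra h
  rw [pow_zero] at h
  exact hn (by rw [coeff_X, if_neg h])

section GroupStructure

variable {K : Type*} [Field K] {p : ℕ} [Fact p.Prime] {e : ℕ}

theorem IsGammaSeries.constantCoeff_eq_zero {f : K⟦X⟧} (hf : IsGammaSeries (p ^ e) f) :
    constantCoeff f = 0 := by
  by_contra h
  rw [← coeff_zero_eq_constantCoeff_apply] at h
  obtain ⟨i, hi⟩ := hf.2 0 h
  exact pow_ne_zero i (pow_ne_zero e (Fact.out : p.Prime).ne_zero) hi.symm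

theorem IsGammaSeries.hasSubst {f : K⟦X⟧} (hf : IsGammaSeries (p ^ e) f) : HasSubst f :=
  HasSubst.of_constantCoeff_zero' hf.constantCoeff_eq_zero

theorem coeff_one_subst {f g : K⟦X⟧} (hf : coeff 1 f = 1)
    (hg0 : constantCoeff g = 0) (hg : coeff 1 g = 1) : coeff 1 (f.subst g) = 1 := by
  rw [coeff_subst' (HasSubst.of_constantCoeff_zero' hg0), finsum_eq_single _ 1]
  · simp [hf, hg]
  · intro d hd
    obtain ⟨B, rfl⟩ : X ∣ g := X_dvd_iff.mpr hg0
    rcases d with _ | _ | d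
    · simp [coeff_one]
    · simp at hd
    · simp [mul_pow, coeff_X_pow_mul']

variable [CharP K p]

theorem IsGammaSeries.subst {f g : K⟦X⟧} (hf : IsGammaSeries (p ^ e) f)
    (hg : IsGammaSeries (p ^ e) g) : IsGammaSeries (p ^ e) (f.subst g) := by
  refine ⟨coeff_one_subst hf.1 hg.constantCoeff_eq_zero hg.1, fun n hn => ?_⟩
  rw [coeff_subst' hg.hasSubst] at hn
  obtain ⟨d, hd⟩ : ∃ d, coeff d f • coeff n (g ^ d) ≠ 0 := by
    by_contra hall
    push Not at hall
    exact hn (by rw [finsum_congr hall, finsum_zero])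
  obtain ⟨i, rfl⟩ := hf.2 d (left_ne_zero_of_smul hd)
  have h2 := right_ne_zero_of_smul hd
  rw [← pow_mul] at h2
  obtain ⟨j, rfl, hj⟩ := exists_of_coeff_pow_ne_zero g _ n h2
  obtain ⟨l, rfl⟩ := hg.2 j hj
  exact ⟨i + l, by rw [← pow_mul, ← pow_mul, ← pow_add]; ring_nf⟩

/-- If `f` and `f ∘ g = X` then `g` is again of the given form. -/
theorem IsGammaSeries.of_subst_eq_X {f g : K⟦X⟧} (hf : IsGammaSeries (p ^ e) f)
    (hg0 : constantCoeff g = 0) (hg : coeff 1 g = 1) (h : f.subst g = X) :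
    IsGammaSeries (p ^ e) g := by
  refine ⟨hg, fun n => ?_⟩
  induction n using Nat.strong_induction_on with
  | _ n ih =>
    intro hn
    by_contra hcon
    have hn1 : n ≠ 1 := fun h1 => hcon ⟨0, by simpa using h1⟩
    have hc : coeff n (f.subst g) = coeff n g := by
      rw [coeff_subst' (HasSubst.of_constantCoeff_zero' hg0), finsum_eq_single _ 1]
      · simp [hf.1]
      · intro d hd
        by_contra hne
        obtain ⟨i, rfl⟩ := hf.2 d (left_ne_zero_of_smul hne)
        have h2 := right_ne_zero_of_smul hne
        rw [← pow_mul] at h2 hd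
        obtain ⟨j, rfl, hj⟩ := exists_of_coeff_pow_ne_zero g _ n h2
        have hj0 : j ≠ 0 := by
          rintro rfl
          simp [hg0] at hj
        have hpp : 0 < p ^ (e * i) := pow_pos (Fact.out : p.Prime).pos _
        have hlt : j < p ^ (e * i) * j := by
          have : 2 ≤ p ^ (e * i) := by omega
          nlinarith [Nat.pos_of_ne_zero hj0]
        obtain ⟨l, rfl⟩ := ih j hlt hj
        exact hcon ⟨i + l, by rw [← pow_mul, ← pow_mul, ← pow_add]; ring_nf⟩
    rw [h, coeff_X, if_neg hn1] at hc
    exact hn hc.symm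

/-- Multiplication is composition of power series, `(f * g)(X) = f(g(X))`. -/
instance : Mul (Gamma (p ^ e) K) where
  mul f g := ⟨f.1.subst g.1, f.2.subst g.2⟩

instance : One (Gamma (p ^ e) K) where
  one := ⟨X, isGammaSeries_X⟩

theorem exists_right_inverse (f : Gamma (p ^ e) K) : ∃ g : Gamma (p ^ e) K, f * g = 1 := by
  let _ : Invertible (coeff 1 f.1) := by rw [f.2.1]; exact invertibleOne
  have hc : coeff 1 f.1.substInv = 1 := by
    rw [coeff_one_substInv, invOf_eq_inv, f.2.1, inv_one]
  have h := subst_substInv_right f.1 f.2.constantCoeff_eq_zero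
  exact ⟨⟨f.1.substInv, f.2.of_subst_eq_X (constantCoeff_substInv _) hc h⟩, Subtype.ext h⟩

instance : Inv (Gamma (p ^ e) K) where
  inv f := (exists_right_inverse f).choose

/-- The group of series `X + ∑_{i ≥ 1} a_i X ^ (q ^ i)`, `q = p ^ e`, under composition. -/
instance : Group (Gamma (p ^ e) K) :=
  Group.ofRightAxioms
    (fun f g h => Subtype.ext (subst_comp_subst_apply g.2.hasSubst h.2.hasSubst f.1))
    (fun f => Subtype.ext (X_subst f.1))
    (fun f => (exists_right_inverse f).choose_spec)

end GroupStructure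

/-- The unit `F ∘ γ` of `K[[X]]`, for a unit `F` and `γ ∈ Γ`. -/
def compGamma {K : Type*} [Field K] {p : ℕ} [Fact p.Prime] {e : ℕ}
    (F : K⟦X⟧ˣ) (γ : Gamma (p ^ e) K) : K⟦X⟧ˣ where
  val := (F : K⟦X⟧).subst γ.1
  inv := ((F⁻¹ : K⟦X⟧ˣ) : K⟦X⟧).subst γ.1
  val_inv := by
    rw [← subst_mul γ.2.hasSubst, Units.mul_inv, ← coe_substAlgHom γ.2.hasSubst, map_one]
  inv_val := by
    rw [← subst_mul γ.2.hasSubst, Units.inv_mul, ← coe_substAlgHom γ.2.hasSubst, map_one]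

/-- Logarithmic differentiation `D[F] = X F' / F` on the units of `K[[X]]`. -/
def logD {K : Type*} [Field K] (F : K⟦X⟧ˣ) : K⟦X⟧ :=
  X * derivative K (F : K⟦X⟧) * ((F⁻¹ : K⟦X⟧ˣ) : K⟦X⟧)

/-- `O_q(c)`: the positive integers `n` prime to `p` with `n ≡ p ^ i * c` mod `q - 1`
for some `i ≥ 0`. -/
def orbit (p q c : ℕ) : Set ℕ :=
  {n | 0 < n ∧ n.Coprime p ∧ ∃ i : ℕ, n ≡ p ^ i * c [MOD (q - 1)]}

/-- `(n + 1) / p ^ (ord_p (n + 1))`, an exact quotient. -/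
def primeToPartSucc (p n : ℕ) : ℕ := (n + 1) / p ^ padicValNat p (n + 1)

/-- The set `C_q^0` of `q`-critical integers. -/
def criticalIntegers (p q : ℕ) : Set ℕ :=
  {c | c ∈ Set.Ioo 0 q ∧ c.Coprime p ∧
    IsLeast (primeToPartSucc p '' (orbit p q c ∩ Set.Ioo 0 q)) (primeToPartSucc p c)}

/-- `C_q = ⋃_{c ∈ C_q^0} {q ^ i * (c + 1) - 1 | i ≥ 0}`. -/
def criticalSet (p q : ℕ) : Set ℕ :=
  ⋃ c ∈ criticalIntegers p q, Set.range fun i : ℕ => q ^ i * (c + 1) - 1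

open Classical in
/-- `ψ_q[∑ a_k X ^ k] = X * ∑_{k ∈ C_q} a_k X ^ k`. -/
def psi {K : Type*} [Field K] (p q : ℕ) (F : K⟦X⟧) : K⟦X⟧ :=
  X * PowerSeries.mk fun k => if k ∈ criticalSet p q then coeff k F else 0

end

end AdditiveGroupSeries

/-! Write β = γ⁻¹ = ∑ b_i X^(q^i) and h = D[F]. Since γ' = 1 and X = β ∘ γ, D[F ∘ γ] = (β · F'/F) ∘
γ (`logD_compGamma`). For k ∈ C_q, k + 1 is a power of p times some 0 < u < q, and at such exponents
k substituting γ leaves coefficients unchanged (`IsGammaSeries.coeff_subst_eq`). So the k-th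
coefficient of D[F ∘ γ] is ∑ b_i h_(k+1-q^i), over q^i ≤ k. Here k + 1 = q^i (l + 1) with l ∈ C_q,
hence h_(k+1-q^i) = h_(q^i l) = h_l^(q^i) (`coeff_pow_mul_logD`), which is the coefficient of
X^(k+1) in ψ[h]^(q^i). For k ∉ C_q both sides vanish, because C_q + 1 is stable under multiplication
by q. -/

namespace AdditiveGroupSeries

open PowerSeries

/-! ### Frobenius powers and the p-power rule for logarithmic derivatives -/

section PowersInCharP

variable {K : Type*} [Field K] {p : ℕ} [hp : Fact p.Prime] [CharP K p]

theorem map_iterateFrobenius_expand_eq_pow (g : K⟦X⟧) (k : ℕ) :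
    (PowerSeries.expand (p ^ k) (pow_ne_zero k hp.out.ne_zero) g).map (iterateFrobenius K p k)
      = g ^ p ^ k :=
  MvPowerSeries.map_iterateFrobenius_expand p hp.out.ne_zero g k

theorem coeff_mul_pow_prime_pow (g : K⟦X⟧) (k j : ℕ) :
    coeff (p ^ k * j) (g ^ p ^ k) = coeff j g ^ p ^ k := by
  rw [← map_iterateFrobenius_expand_eq_pow, coeff_map, coeff_expand_mul, iterateFrobenius_def]

theorem coeff_mul_pow_prime (g : K⟦X⟧) (j : ℕ) : coeff (p * j) (g ^ p) = coeff j g ^ p := by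
  simpa using coeff_mul_pow_prime_pow g 1 j

theorem exists_of_coeff_pow_prime_ne_zero {g : K⟦X⟧} {m : ℕ} (h : coeff m (g ^ p) ≠ 0) :
    p ∣ m := by
  obtain ⟨j, hj, -⟩ := exists_of_coeff_pow_ne_zero (p := p) g 1 m (by simpa using h)
  exact ⟨j, by simpa using hj⟩

/-- If the coefficients of `A` at all multiples of `p` vanish, so do those of `A * B ^ p`. -/
theorem coeff_mul_pow_prime_eq_zero {A : K⟦X⟧} (hA : ∀ j, coeff (p * j) A = 0) (B : K⟦X⟧)
    (j : ℕ) : coeff (p * j) (A * B ^ p) = 0 := by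
  rw [coeff_mul]
  refine Finset.sum_eq_zero fun x hx => ?_
  by_contra hne
  obtain ⟨l, hl⟩ := exists_of_coeff_pow_prime_ne_zero (right_ne_zero_of_mul hne)
  obtain ⟨i, hi⟩ : p ∣ x.1 := by
    rw [Finset.HasAntidiagonal.mem_antidiagonal] at hx
    exact (Nat.dvd_add_left ⟨l, hl⟩).mp ⟨j, hx⟩
  exact left_ne_zero_of_mul hne (by rw [hi, hA])

/-- The coefficients of `F ^ (p - 1) * X F'` at multiples of `p`, which come from the identity
`(F ^ p)' = p F ^ (p - 1) F'` in characteristic zero. -/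
theorem coeff_pow_mul_X_mul_derivative (F : K⟦X⟧) (j : ℕ) :
    coeff (p * j) (F ^ (p - 1) * (X * derivative K F)) = coeff j (X * derivative K F) ^ p := by
  -- `G` lifts `F` to a characteristic-zero domain, with the variable indexed by `a` evaluating to
  -- `a`; there the factor p can be cancelled.
  let φ : MvPolynomial K ℤ →+* K := (MvPolynomial.aeval (id : K → K)).toRingHom
  let G : (MvPolynomial K ℤ)⟦X⟧ := PowerSeries.mk fun n => MvPolynomial.X (coeff n F)
  have hG : G.map φ = F := by
    ext n
    simp [G, φ]
  have hX : ∀ (R : Type _) [CommRing R] (f : R⟦X⟧) (n : ℕ),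
      coeff n (X * derivative R f) = n * coeff n f := by
    intro R _ f n
    cases n with
    | zero => simp
    | succ n => rw [coeff_succ_X_mul, coeff_derivative]; push_cast; ring
  have key : coeff (p * j) (G ^ (p - 1) * (X * derivative _ G)) = j * coeff (p * j) (G ^ p) := by
    have h := hX _ (G ^ p) (p * j)
    rw [derivative_pow, show X * ((p : (MvPolynomial K ℤ)⟦X⟧) * G ^ (p - 1) * derivative _ G)
      = C (p : MvPolynomial K ℤ) * (G ^ (p - 1) * (X * derivative _ G)) by
        rw [map_natCast]; ring, coeff_C_mul] at h
    have hp0 : (p : MvPolynomial K ℤ) ≠ 0 := Nat.cast_ne_zero.mpr hp.out.ne_zero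
    refine mul_left_cancel₀ hp0 (h.trans ?_)
    push_cast
    ring
  have hmap : (derivative _ G).map φ = derivative K F := by
    ext n
    rw [coeff_map, coeff_derivative, coeff_derivative, ← hG, coeff_map]
    simp
  have key' := congrArg φ key
  rw [map_mul φ, map_natCast, ← coeff_map, ← coeff_map, map_mul (PowerSeries.map φ),
    map_mul (PowerSeries.map φ), map_pow (PowerSeries.map φ), map_pow (PowerSeries.map φ), hG, hmap,
    map_X, coeff_mul_pow_prime] at key'
  rw [key', hX, mul_pow, ← frobenius_def (p := p) (j : K), map_natCast]

/-- The coefficients of a logarithmic derivative satisfy `h_{p j} = h_j ^ p`. -/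
theorem coeff_mul_logD (F : K⟦X⟧ˣ) (j : ℕ) : coeff (p * j) (logD F) = coeff j (logD F) ^ p := by
  have hF : (F : K⟦X⟧) * ((F⁻¹ : K⟦X⟧ˣ) : K⟦X⟧) = 1 := F.mul_inv
  -- With H = D[F], (H - H^p) F^p = F^(p-1) · XF' - (XF')^p. Multiplying by F^(-p) afterwards
  -- preserves vanishing at multiples of p.
  have hA : ∀ j, coeff (p * j) ((logD F - logD F ^ p) * (F : K⟦X⟧) ^ p) = 0 := by
    intro j
    have hH : logD F * (F : K⟦X⟧) = X * derivative K (F : K⟦X⟧) := by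
      rw [logD, mul_assoc, mul_comm _ (F : K⟦X⟧), hF, mul_one]
    have h1 : (logD F - logD F ^ p) * (F : K⟦X⟧) ^ p
        = (F : K⟦X⟧) ^ (p - 1) * (X * derivative K (F : K⟦X⟧))
          - (X * derivative K (F : K⟦X⟧)) ^ p := by
      rw [← hH, mul_pow, ← Nat.sub_add_cancel hp.out.one_le, Nat.add_sub_cancel]
      ring
    rw [h1, map_sub, coeff_pow_mul_X_mul_derivative, coeff_mul_pow_prime, sub_self]
  have h := coeff_mul_pow_prime_eq_zero hA ((F⁻¹ : K⟦X⟧ˣ) : K⟦X⟧) j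
  rw [mul_assoc, ← mul_pow, hF, one_pow, mul_one, map_sub, coeff_mul_pow_prime] at h
  exact sub_eq_zero.mp h

theorem coeff_pow_mul_logD (F : K⟦X⟧ˣ) (k j : ℕ) :
    coeff (p ^ k * j) (logD F) = coeff j (logD F) ^ p ^ k := by
  induction k with
  | zero => simp
  | succ k ih => rw [pow_succ', mul_assoc, coeff_mul_logD, ih, ← pow_mul, mul_comm p]

end PowersInCharP

theorem IsGammaSeries.derivative_eq_one {K : Type*} [Field K] {p : ℕ} [CharP K p] {e : ℕ} {f : K⟦X⟧}
    (he : e ≠ 0) (hf : IsGammaSeries (p ^ e) f) :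
    derivative K f = 1 := by
  ext n
  rw [coeff_derivative, coeff_one]
  split_ifs with hn
  · simp [hn, hf.1]
  · by_contra hne
    obtain ⟨i, hi⟩ := hf.2 _ (left_ne_zero_of_mul hne)
    have hi0 : i ≠ 0 := by
      rintro rfl
      rw [pow_zero] at hi
      omega
    apply right_ne_zero_of_mul hne
    rw [← Nat.cast_succ, Nat.succ_eq_add_one, hi, CharP.cast_eq_zero_iff K p]
    exact dvd_pow (dvd_pow_self p he) hi0

/-! ### Substitution of series in Γ -/

section GammaSeries

variable {K : Type*} [Field K] {p : ℕ} [hp : Fact p.Prime] {e : ℕ} {f : K⟦X⟧}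

theorem IsGammaSeries.X_pow_dvd_sub_X {q : ℕ} (hf : IsGammaSeries q f) :
    (X : K⟦X⟧) ^ q ∣ f - X := by
  rw [X_pow_dvd_iff]
  intro m hm
  rw [map_sub, coeff_X]
  by_cases h1 : m = 1
  · rw [if_pos h1, h1, hf.1, sub_self]
  · rw [if_neg h1, sub_zero]
    by_contra hne
    obtain ⟨i, rfl⟩ := hf.2 m hne
    have hi : i ≠ 0 := by
      rintro rfl
      exact h1 (pow_zero q)
    exact absurd hm (not_lt.mpr (Nat.le_self_pow hi q))

/-- A series of the given form with `q = p ^ e` differs from `X` by a series in `X ^ p`. -/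
theorem IsGammaSeries.exists_eq_X_add_expand (he : e ≠ 0) (hf : IsGammaSeries (p ^ e) f) :
    ∃ g : K⟦X⟧, f = X + PowerSeries.expand p hp.out.ne_zero g := by
  refine ⟨PowerSeries.mk fun n => coeff (p * n) (f - X), ?_⟩
  ext n
  rw [map_add, coeff_expand]
  split_ifs with hd
  · rw [coeff_mk, Nat.mul_div_cancel' hd, map_sub, add_sub_cancel]
  · rw [add_zero, coeff_X]
    split_ifs with h1
    · rw [h1, hf.1]
    · by_contra hne
      obtain ⟨i, rfl⟩ := hf.2 n hne
      have hi : i ≠ 0 := by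
        rintro rfl
        exact h1 (pow_zero _)
      exact hd (dvd_pow (dvd_pow_self p he) hi)

variable [CharP K p]

/-- The coefficients of `f ^ M` at exponents congruent to `-1` modulo `p`. -/
theorem IsGammaSeries.coeff_pow_mul_add (he : e ≠ 0) (hf : IsGammaSeries (p ^ e) f)
    (E M d : ℕ) (hd : d < p) :
    coeff (p * E + (p - 1)) (f ^ (p * M + d)) =
      if d = p - 1 then coeff E (f ^ M) ^ p else 0 := by
  obtain ⟨g, hg⟩ := hf.exists_eq_X_add_expand he
  have hpow : ∀ h : K⟦X⟧, h ^ p = PowerSeries.expand p hp.out.ne_zero (h.map (frobenius K p)) := by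
    intro h
    have := map_iterateFrobenius_expand_eq_pow (p := p) h 1
    simp only [pow_one, map_expand, iterateFrobenius_one] at this
    exact this.symm
  have hsum : f ^ (p * M + d) = ∑ i ∈ Finset.range (d + 1), X ^ i *
      PowerSeries.expand p hp.out.ne_zero
        ((f ^ M).map (frobenius K p) * g ^ (d - i) * (d.choose i : K⟦X⟧)) := by
    rw [pow_add, mul_comm p, pow_mul, hpow (f ^ M)]
    conv_lhs => rw [show f ^ d = (X + PowerSeries.expand p hp.out.ne_zero g) ^ d by rw [← hg]]
    rw [add_pow, Finset.mul_sum]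
    refine Finset.sum_congr rfl fun i _ => ?_
    rw [map_mul, map_mul, map_pow (PowerSeries.expand p hp.out.ne_zero), map_natCast]
    ring
  -- X^i times a series in X^p has only exponents ≡ i mod p, so with i ≤ d < p only i = p - 1
  -- reaches the class of -1.
  have hne : ∀ i ∈ Finset.range (d + 1), i ≠ p - 1 → ∀ h : K⟦X⟧,
      coeff (p * E + (p - 1)) (X ^ i * PowerSeries.expand p hp.out.ne_zero h) = 0 := by
    intro i hi hip h
    rw [Finset.mem_range] at hi
    rw [coeff_X_pow_mul', if_pos (by omega), coeff_expand_of_not_dvd]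
    rw [Nat.add_sub_assoc (by omega), Nat.dvd_add_right (dvd_mul_right p E)]
    exact Nat.not_dvd_of_pos_of_lt (by omega) (by omega)
  rw [hsum, map_sum]
  split_ifs with hdp
  · rw [Finset.sum_eq_single_of_mem d (by simp) (fun i hi hid => hne i hi (by omega) _),
      coeff_X_pow_mul', if_pos (by omega), hdp, Nat.add_sub_cancel, coeff_expand_mul,
      Nat.sub_self, pow_zero, mul_one, Nat.choose_self, Nat.cast_one, mul_one, coeff_map,
      frobenius_def]
  · refine Finset.sum_eq_zero fun i hi => hne i hi ?_ _
    rw [Finset.mem_range] at hi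
    omega

/-- For `N = p ^ s * u` with `0 < u < q`, the coefficient of `X ^ (N - 1)` in `f ^ M` is that of
`X ^ M`. -/
theorem IsGammaSeries.coeff_pow_eq (he : e ≠ 0) (hf : IsGammaSeries (p ^ e) f) (s : ℕ) {u : ℕ}
    (hu0 : 0 < u) (hu : u < p ^ e) (M : ℕ) :
    coeff (p ^ s * u - 1) (f ^ M) = if p ^ s * u - 1 = M then 1 else 0 := by
  have hp2 := hp.out.two_le
  induction s generalizing M with
  | zero =>
    -- Here f^M ≡ X^M mod X^q, and u - 1 < q.
    have h := X_pow_dvd_iff.mp (hf.X_pow_dvd_sub_X.trans (sub_dvd_pow_sub_pow f X M))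
      (p ^ 0 * u - 1) (by rw [pow_zero]; omega)
    rw [map_sub, coeff_X_pow] at h
    exact sub_eq_zero.mp h
  | succ s ih =>
    obtain ⟨E, hE⟩ : ∃ E, p ^ s * u = E + 1 :=
      ⟨p ^ s * u - 1, (Nat.sub_add_cancel (Nat.mul_pos (pow_pos hp.out.pos s) hu0)).symm⟩
    -- The exponent is -1 mod p, so `coeff_pow_mul_add` descends to exponent E = p^s u - 1.
    have hN : p ^ (s + 1) * u - 1 = p * E + (p - 1) := by
      rw [pow_succ', mul_assoc, hE, mul_add]
      omega
    have hlt := Nat.mod_lt M hp.out.pos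
    rw [hN]
    conv_lhs => rw [← Nat.div_add_mod M p]
    rw [hf.coeff_pow_mul_add he _ _ _ hlt, show coeff E (f ^ (M / p)) = if E = M / p then 1 else 0 by
      simpa only [hE, Nat.add_sub_cancel] using ih (M / p)]
    by_cases hM : p * E + (p - 1) = M
    · have h1 : M / p = E := by
        rw [← hM, Nat.mul_add_div hp.out.pos, Nat.div_eq_of_lt (by omega), add_zero]
      have h2 : M % p = p - 1 := by
        rw [← hM, Nat.mul_add_mod, Nat.mod_eq_of_lt (by omega)]
      simp [hM, h1, h2]
    · rw [if_neg hM]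
      split_ifs with h1 h2
      · exact absurd (by rw [h2, ← h1, Nat.div_add_mod]) hM
      · exact zero_pow hp.out.ne_zero
      · rfl

/-- Substituting a series of the given form does not change the coefficient of `X ^ (N - 1)`,
for `N = p ^ s * u` with `0 < u < q`. -/
theorem IsGammaSeries.coeff_subst_eq (he : e ≠ 0) (hf : IsGammaSeries (p ^ e) f) (s : ℕ) {u : ℕ}
    (hu0 : 0 < u) (hu : u < p ^ e) (g : K⟦X⟧) :
    coeff (p ^ s * u - 1) (g.subst f) = coeff (p ^ s * u - 1) g := by
  rw [coeff_subst' hf.hasSubst, finsum_eq_single _ (p ^ s * u - 1)]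
  · rw [hf.coeff_pow_eq he s hu0 hu, if_pos rfl, smul_eq_mul, mul_one]
  · intro M hM
    rw [hf.coeff_pow_eq he s hu0 hu, if_neg hM.symm, smul_zero]

/-- The logarithmic derivative of `F ∘ γ` in terms of that of `F`. -/
theorem logD_compGamma (he : e ≠ 0) (γ : Gamma (p ^ e) K) (F : K⟦X⟧ˣ) :
    logD (compGamma F γ) =
      ((γ⁻¹).1 * (derivative K (F : K⟦X⟧) * ((F⁻¹ : K⟦X⟧ˣ) : K⟦X⟧))).subst γ.1 := by
  have hinv : (γ⁻¹).1.subst γ.1 = X := congrArg Subtype.val (inv_mul_cancel γ)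
  have hs := γ.2.hasSubst
  rw [subst_mul hs, subst_mul hs, hinv, ← mul_assoc]
  change X * derivative K ((F : K⟦X⟧).subst γ.1) * ((F⁻¹ : K⟦X⟧ˣ) : K⟦X⟧).subst γ.1 = _
  rw [derivative_subst hs, γ.2.derivative_eq_one he, mul_one]

end GammaSeries

/-! ### Shape of C_q and its behaviour under multiplication by q -/

section CriticalSet

variable {p : ℕ}

theorem mem_criticalSet {q k : ℕ} :
    k ∈ criticalSet p q ↔ ∃ c ∈ criticalIntegers p q, ∃ i : ℕ, q ^ i * (c + 1) - 1 = k := by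
  simp [criticalSet]

theorem exists_eq_of_mem_criticalSet {e k : ℕ} (hk : k ∈ criticalSet p (p ^ e)) :
    ∃ s u : ℕ, 0 < u ∧ u < p ^ e ∧ k = p ^ s * u - 1 := by
  obtain ⟨c, hc, i, rfl⟩ := mem_criticalSet.mp hk
  have hlt := hc.1.2
  rcases Nat.lt_or_ge (c + 1) (p ^ e) with h | h
  · exact ⟨e * i, c + 1, c.succ_pos, h, by rw [pow_mul]⟩
  -- When c = q - 1, c + 1 = q is too large for u and is absorbed into the power of p.
  · refine ⟨e * i + e, 1, one_pos, lt_of_le_of_lt hc.1.1 hlt, ?_⟩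
    rw [show c + 1 = p ^ e by omega, pow_add, pow_mul, mul_one]

theorem pos_of_mem_criticalSet {q k : ℕ} (hk : k ∈ criticalSet p q) : 0 < k := by
  obtain ⟨c, hc, i, rfl⟩ := mem_criticalSet.mp hk
  have hc0 := hc.1.1
  have hq : 0 < q ^ i := pow_pos (hc0.trans hc.1.2) i
  have : 1 * (c + 1) ≤ q ^ i * (c + 1) := Nat.mul_le_mul_right _ hq
  omega

theorem mul_succ_sub_one_mem_criticalSet {q k : ℕ} (hk : k ∈ criticalSet p q) (i : ℕ) :
    q ^ i * (k + 1) - 1 ∈ criticalSet p q := by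
  obtain ⟨c, hc, j, rfl⟩ := mem_criticalSet.mp hk
  have hq : 0 < q ^ j * (c + 1) := Nat.mul_pos (pow_pos (hc.1.1.trans hc.1.2) j) c.succ_pos
  refine mem_criticalSet.mpr ⟨c, hc, i + j, ?_⟩
  rw [Nat.sub_add_cancel hq, pow_add, mul_assoc]

/-- With k + 1 = q^m (c + 1) and c + 1 ≤ q, the bound q^i < k + 1 ≤ q^(m+1) forces i ≤ m. -/
theorem exists_eq_mul_of_mem_criticalSet {q k i : ℕ} (hk : k ∈ criticalSet p q)
    (hi : q ^ i ≤ k) : ∃ l ∈ criticalSet p q, k + 1 = q ^ i * (l + 1) := by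
  obtain ⟨c, hc, m, rfl⟩ := mem_criticalSet.mp hk
  have hcq := hc.1.2
  have hc0 := hc.1.1
  have hq : 1 < q := lt_of_le_of_lt hc0 hcq
  have hpos : ∀ m, 0 < q ^ m * (c + 1) := fun m => Nat.mul_pos (pow_pos (by omega) m) c.succ_pos
  have him : i ≤ m := by
    have h1 : q ^ i < q ^ (m + 1) := by
      have := hpos m
      calc q ^ i < q ^ m * (c + 1) := by omega
        _ ≤ q ^ m * q := Nat.mul_le_mul_left _ hcq
        _ = q ^ (m + 1) := (pow_succ q m).symm
    exact Nat.lt_succ_iff.mp ((Nat.pow_lt_pow_iff_right hq).mp h1)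
  refine ⟨q ^ (m - i) * (c + 1) - 1, mem_criticalSet.mpr ⟨c, hc, m - i, rfl⟩, ?_⟩
  rw [Nat.sub_add_cancel (hpos _), Nat.sub_add_cancel (hpos _), ← mul_assoc, ← pow_add,
    Nat.add_sub_cancel' him]

end CriticalSet

/-! ### Coefficients of q^i-th powers of ψ -/

section Psi

variable {K : Type*} [Field K] {p : ℕ}

theorem coeff_zero_psi (q : ℕ) (H : K⟦X⟧) : coeff 0 (psi p q H) = 0 := by
  simp [psi]

theorem coeff_succ_psi_of_mem {q k : ℕ} (hk : k ∈ criticalSet p q) (H : K⟦X⟧) :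
    coeff (k + 1) (psi p q H) = coeff k H := by
  rw [psi, coeff_succ_X_mul, coeff_mk, if_pos hk]

theorem coeff_succ_psi_of_notMem {q k : ℕ} (hk : k ∉ criticalSet p q) (H : K⟦X⟧) :
    coeff (k + 1) (psi p q H) = 0 := by
  rw [psi, coeff_succ_X_mul, coeff_mk, if_neg hk]

variable [hp : Fact p.Prime] [CharP K p]

theorem coeff_succ_psi_pow_of_notMem {e k : ℕ} (hk : k ∉ criticalSet p (p ^ e)) (H : K⟦X⟧)
    (i : ℕ) : coeff (k + 1) (psi p (p ^ e) H ^ (p ^ e) ^ i) = 0 := by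
  by_contra hne
  rw [← pow_mul] at hne
  obtain ⟨j, hj, hj0⟩ := exists_of_coeff_pow_ne_zero _ _ _ hne
  rcases j with _ | l
  · exact hj0 (coeff_zero_psi _ _)
  · have hl : l ∈ criticalSet p (p ^ e) := by
      by_contra hl
      exact hj0 (coeff_succ_psi_of_notMem hl H)
    have := mul_succ_sub_one_mem_criticalSet hl i
    rw [← pow_mul, ← hj, Nat.add_sub_cancel] at this
    exact hk this

theorem coeff_succ_psi_logD_pow_of_mem {e k : ℕ} (hk : k ∈ criticalSet p (p ^ e)) (F : K⟦X⟧ˣ)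
    {i : ℕ} (hi : (p ^ e) ^ i ≤ k) :
    coeff (k + 1) (psi p (p ^ e) (logD F) ^ (p ^ e) ^ i) =
      coeff (k - (p ^ e) ^ i) (derivative K (F : K⟦X⟧) * ((F⁻¹ : K⟦X⟧ˣ) : K⟦X⟧)) := by
  obtain ⟨l, hl, hkl⟩ := exists_eq_mul_of_mem_criticalSet hk hi
  rw [hkl, ← coeff_succ_X_mul (k - (p ^ e) ^ i), ← mul_assoc]
  change _ = coeff _ (logD F)
  have hsub : k - (p ^ e) ^ i + 1 = p ^ (e * i) * l := by
    rw [mul_add, mul_one] at hkl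
    rw [pow_mul]
    omega
  rw [hsub, ← pow_mul, coeff_mul_pow_prime_pow, coeff_succ_psi_of_mem hl, coeff_pow_mul_logD]

/-- As 0 ∉ C_q, ψ[H] has order at least 2, so its q^i-th power has order at least 2q^i > k + 1. -/
theorem coeff_succ_psi_pow_eq_zero {e k i : ℕ} (hi : k < (p ^ e) ^ i) (H : K⟦X⟧) :
    coeff (k + 1) (psi p (p ^ e) H ^ (p ^ e) ^ i) = 0 := by
  by_contra hne
  rw [← pow_mul] at hne hi
  obtain ⟨j, hj, hj0⟩ := exists_of_coeff_pow_ne_zero _ _ _ hne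
  rcases j with _ | _ | j
  · exact hj0 (coeff_zero_psi _ _)
  · refine hj0 (coeff_succ_psi_of_notMem (fun h => ?_) H)
    exact (pos_of_mem_criticalSet h).ne' rfl
  · have : p ^ (e * i) * 2 ≤ p ^ (e * i) * (j + 1 + 1) := Nat.mul_le_mul_left _ (by omega)
    omega

end Psi

end AdditiveGroupSeries

open AdditiveGroupSeries PowerSeries in
theorem theorem1p1 {K : Type*} [Field K] (p : ℕ) [Fact p.Prime] [CharP K p] (e : ℕ) (he : 0 < e)
    (γ : AdditiveGroupSeries.Gamma (p ^ e) K) (F : (PowerSeries K)ˣ) :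
    AdditiveGroupSeries.psi p (p ^ e)
        (AdditiveGroupSeries.logD (AdditiveGroupSeries.compGamma F γ)) =
      PowerSeries.subst
        (AdditiveGroupSeries.psi p (p ^ e) (AdditiveGroupSeries.logD F)) (γ⁻¹).1 := by
  set P := psi p (p ^ e) (logD F) with hP
  set β := γ⁻¹
  have h0 : constantCoeff P = 0 := by
    rw [← coeff_zero_eq_constantCoeff_apply, hP, coeff_zero_psi]
  have hs : HasSubst P := HasSubst.of_constantCoeff_zero' h0
  ext n
  rw [coeff_subst' hs]
  rcases n with _ | k
  · rw [coeff_zero_psi, finsum_eq_zero_of_forall_eq_zero]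
    intro d
    rcases d with _ | d
    · simp [β.2.constantCoeff_eq_zero]
    · simp [h0]
  by_cases hk : k ∈ criticalSet p (p ^ e)
  · obtain ⟨s, u, hu0, hu, hsu⟩ := exists_eq_of_mem_criticalSet hk
    rw [coeff_succ_psi_of_mem hk, logD_compGamma he.ne']
    conv_lhs => rw [hsu, γ.2.coeff_subst_eq he.ne' s hu0 hu, ← hsu]
    -- Both sides become sums over exponents d ≤ k of β: the product has no others, and on the
    -- composition side larger d contribute zero.
    rw [coeff_mul, Finset.Nat.sum_antidiagonal_eq_sum_range_succ_mk,
      finsum_eq_sum_of_support_subset (s := Finset.range (k + 1))]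
    · refine Finset.sum_congr rfl fun d hd => ?_
      by_cases hd0 : coeff d β.1 = 0
      · rw [hd0, zero_mul, zero_smul]
      · obtain ⟨i, rfl⟩ := β.2.2 d hd0
        rw [smul_eq_mul, coeff_succ_psi_logD_pow_of_mem hk F
          (Nat.lt_succ_iff.mp (Finset.mem_range.mp hd))]
    · intro d hd
      rw [Function.mem_support] at hd
      obtain ⟨i, rfl⟩ := β.2.2 d (left_ne_zero_of_smul hd)
      rw [Finset.coe_range, Set.mem_Iio, Nat.lt_succ_iff]
      by_contra hlt
      exact right_ne_zero_of_smul hd (coeff_succ_psi_pow_eq_zero (not_le.mp hlt) _)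
  · rw [coeff_succ_psi_of_notMem hk, finsum_eq_zero_of_forall_eq_zero]
    intro d
    by_cases hd0 : coeff d β.1 = 0
    · rw [hd0, zero_smul]
    · obtain ⟨i, rfl⟩ := β.2.2 d hd0
      rw [coeff_succ_psi_pow_of_notMem hk, smul_zero]
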